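/- Let $G$ be the following plane configuration in a disc (a 4-tangle configuration): a plane graph with nine 4-valent vertices $A,B,C,D,E,F,M,L,R$ and eight endpoints on the boundary of the disc. Its fourteen inner edges are $AB,BC,CD,DA$, $EA,EB$, $FC,FD$, $MB,MC$, $ML,MR$, $LE,RF$, and its inner faces are three squares $ABCD$, $EBML$, $FCMR$ and three triangles $EAB$, $FCD$, $MBC$ (so $E$ lies to the left, $F$ to the right of and $M$ below the central square, whose corners are $A$ top left, $B$ bottom left, $C$ bottom right, $D$ top right). The eight endpoints of the disc, in counterclockwise order starting at the left, are joined to $E,L,L,R,R,F,D,A$. A tangle diagram is *supported* by $G$ if, up to planar isotopy relative to the endpoints, it arises from $G$ by replacing each vertex by one of the two possible crossings. A *3-move* replaces two parallel strands of a diagram by three half twists (of either handedness), or conversely. Two tangle diagrams with the same endpoints are *3-move equivalent* if they are related by a finite sequence of planar isotopies relative to the endpoints, Reidemeister moves and 3-moves. **Lemma.** Every tangle diagram supported by $G$ (it has 9 crossings) is 3-move equivalent to a tangle diagram, with the same eight endpoints, that has fewer than 9 crossings. -/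

import Mathlib

/-!
Tangle diagrams in general position with respect to the height function, read from top to bottom.
At every level the diagram meets a horizontal line in finitely many strands, numbered `0, 1, 2, …`
from left to right, and between two consecutive levels exactly one event takes place.  The position
of an event is the number of strands to the left of it.
-/

/-- The events of a tangle diagram: a local maximum (two new neighbouring strands appear), a local
minimum (two neighbouring strands are joined and disappear), or a crossing of two neighbouring
strands.  In `crossing true` the over-strand runs from top left to bottom right, in
`crossing false` it runs from top right to bottom left. -/
inductive PieceKind where
  | maximum : PieceKind
  | minimum : PieceKind
  | crossing (s : Bool) : PieceKind
  deriving DecidableEq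

/-- Number of strands entering an event from above. -/
def PieceKind.ins : PieceKind → ℕ
  | .maximum => 0
  | .minimum => 2
  | .crossing _ => 2

/-- Number of strands leaving an event below. -/
def PieceKind.outs : PieceKind → ℕ
  | .maximum => 2
  | .minimum => 0
  | .crossing _ => 2

/-- An event together with the number of strands to the left of it. -/
structure Piece where
  kind : PieceKind
  pos : ℕ
  deriving DecidableEq

/-- A local maximum creating the strands `i`, `i + 1`. -/
def maxAt (i : ℕ) : Piece := ⟨.maximum, i⟩

/-- A local minimum joining the strands `i`, `i + 1`. -/
def minAt (i : ℕ) : Piece := ⟨.minimum, i⟩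

/-- A crossing of the strands `i`, `i + 1`. -/
def crossAt (i : ℕ) (s : Bool) : Piece := ⟨.crossing s, i⟩

/-- `IsTangleWord m l n`: the events `l`, performed from top to bottom, start with `m` strands, are
all possible, and end with `n` strands. -/
def IsTangleWord : ℕ → List Piece → ℕ → Prop
  | m, [], n => m = n
  | m, x :: l, n =>
      x.pos + x.kind.ins ≤ m ∧ IsTangleWord (m - x.kind.ins + x.kind.outs) l n

/-- An unoriented tangle diagram in a rectangle, with `m` fixed endpoints on the top side and `n`
fixed endpoints on the bottom side.  Closed components are allowed.  A diagram of a `k`-tangle has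
`m + n = 2 * k` endpoints. -/
@[ext] structure TangleDiagram (m n : ℕ) where
  pieces : List Piece
  isTangleWord : IsTangleWord m pieces n

/-- Whether an event is a crossing. -/
def Piece.isCrossing (x : Piece) : Bool :=
  match x.kind with
  | .crossing _ => true
  | _ => false

/-- The number of crossings of a tangle diagram. -/
def TangleDiagram.numCrossings {m n : ℕ} (D : TangleDiagram m n) : ℕ :=
  D.pieces.countP Piece.isCrossing

/-- The local modifications of a sliced diagram which realize planar isotopy (rel boundary). -/
inductive PlanarMove : List Piece → List Piece → Prop
  /-- Two events side by side are performed in either order; `k` is the number of strands between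
  them. -/
  | exchange (a b : PieceKind) (i k : ℕ) :
      PlanarMove [⟨a, i⟩, ⟨b, i + a.outs + k⟩] [⟨b, i + a.ins + k⟩, ⟨a, i⟩]
  /-- Straightening of a zigzag. -/
  | zigzag_right (i : ℕ) : PlanarMove [maxAt i, minAt (i + 1)] []
  /-- Straightening of a zigzag. -/
  | zigzag_left (i : ℕ) : PlanarMove [maxAt (i + 1), minAt i] []
  /-- A crossing slides along a strand through a local minimum. -/
  | slide_min (i : ℕ) (s : Bool) :
      PlanarMove [crossAt (i + 1) s, minAt i] [crossAt i (!s), minAt (i + 1)]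
  /-- A crossing slides along a strand through a local maximum. -/
  | slide_max (i : ℕ) (s : Bool) :
      PlanarMove [maxAt i, crossAt (i + 1) s] [maxAt (i + 1), crossAt i (!s)]

/-- The Reidemeister moves. -/
inductive ReidemeisterMove : List Piece → List Piece → Prop
  | r1_max (i : ℕ) (s : Bool) : ReidemeisterMove [maxAt i, crossAt i s] [maxAt i]
  | r1_min (i : ℕ) (s : Bool) : ReidemeisterMove [crossAt i s, minAt i] [minAt i]
  | r2 (i : ℕ) (s : Bool) : ReidemeisterMove [crossAt i s, crossAt i (!s)] []
  /-- `s`, `t`, `u` are the crossings of the first and second, the first and third, and the second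
  and third strand.  The hypothesis says that the three strands lie at three different heights:
  only `s = u ≠ t` is a cyclic pattern. -/
  | r3 (i : ℕ) (s t u : Bool) (h : s = t ∨ t = u) :
      ReidemeisterMove [crossAt i s, crossAt (i + 1) t, crossAt i u]
        [crossAt (i + 1) u, crossAt i t, crossAt (i + 1) s]

/-- The 3-move: two parallel strands are replaced by three half twists, of either handedness. -/
inductive ThreeMove : List Piece → List Piece → Prop
  | twist (i : ℕ) (s : Bool) : ThreeMove [] [crossAt i s, crossAt i s, crossAt i s]

/-- `D'` arises from `D` by one application of the local modification `R`, the rest of the diagram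
being unchanged. -/
def TangleDiagram.StepBy (R : List Piece → List Piece → Prop) {m n : ℕ}
    (D D' : TangleDiagram m n) : Prop :=
  ∃ u x y v : List Piece, R x y ∧ D.pieces = u ++ x ++ v ∧ D'.pieces = u ++ y ++ v

/-- Planar isotopy of tangle diagrams, relative to the endpoints. -/
def TangleDiagram.PlanarIsotopic {m n : ℕ} (D D' : TangleDiagram m n) : Prop :=
  Relation.EqvGen (TangleDiagram.StepBy PlanarMove) D D'

/-- Two tangle diagrams with the same endpoints are 3-move equivalent if they are related by a
finite sequence of planar isotopies, Reidemeister moves, 3-moves and their inverses. -/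
def TangleDiagram.ThreeMoveEquivalent {m n : ℕ} (D D' : TangleDiagram m n) : Prop :=
  Relation.EqvGen (TangleDiagram.StepBy fun x y =>
    PlanarMove x y ∨ ReidemeisterMove x y ∨ ThreeMove x y) D D'

/-- The events of a sliced plane graph all of whose inner vertices are 4-valent. -/
inductive GraphPiece where
  | maximum (pos : ℕ) : GraphPiece
  | minimum (pos : ℕ) : GraphPiece
  | vertex (pos : ℕ) : GraphPiece
  deriving DecidableEq

/-- Forget which strand of a crossing is the upper one: crossings become 4-valent vertices. -/
def Piece.toGraphPiece : Piece → GraphPiece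
  | ⟨.maximum, i⟩ => .maximum i
  | ⟨.minimum, i⟩ => .minimum i
  | ⟨.crossing _, i⟩ => .vertex i

/-- A configuration: a plane 4-valent graph with endpoints on the boundary, in sliced form. -/
abbrev Configuration := List GraphPiece

/-- The diagram `D` is supported by the configuration `G`: up to planar isotopy it arises from `G`
by choosing one of the two crossings at each vertex of `G`. -/
def TangleDiagram.SupportedBy {m n : ℕ} (D : TangleDiagram m n) (G : Configuration) : Prop :=
  ∃ D' : TangleDiagram m n, D.PlanarIsotopic D' ∧ D'.pieces.map Piece.toGraphPiece = G

/-- The 4-tangle configuration with nine vertices `A, B, C, D, E, F, M, L, R` and eight endpoints,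
four on the top side and four on the bottom side:

```
      1    2     3    4
       \   |     |   /
        \ /A-----D\ /
         E |     | F
        / \B-----C/ \
       |    \   /    |
       |      M      |
       |    /   \    |
        L--       --R
       / \         / \
      5   6       7   8
```

The fourteen edges are `AB, BC, CD, DA, EA, EB, FC, FD, MB, MC, ML, MR, LE, RF`, the six inner
faces are the squares `ABCD`, `EBML`, `FCMR` and the triangles `EAB`, `FCD`, `MBC`, and the endpoints are attached, from left to right, to
`E, A, D, F` on top and to `L, L, R, R` at the bottom. -/
def nineVertexConfiguration : Configuration :=
  [.maximum 2,
   .vertex 1,  -- A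
   .vertex 3,  -- D
   .vertex 0,  -- E
   .vertex 4,  -- F
   .vertex 1,  -- B
   .vertex 3,  -- C
   .minimum 2,
   .vertex 1,  -- M
   .vertex 0,  -- L
   .vertex 2]  -- R

/-!
After turning part of the disc, a diagram supported by the configuration becomes a braid on four
strands, with word `a b c b a b c b a` and a sign at each letter, two of whose upper and two of
whose lower ends are bent around. Up to 3-moves such braids may be computed in the quotient of the
braid group by the cubes of its generators. There a block `b c b` with signs is either a block
`c b c` with signs or `z c^±1`, where `z` is the full twist on the last three strands, and likewise
for `a b a` and the full twist `w` on the first three. The twists `z` and `w` are involutions, each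
central in its three-strand quotient, and `z a z = w c w`. Flipping both blocks `b c b` or trading
them for twists then leaves at most eight letters in every case.
-/

section CubicBraid

open scoped Pointwise

variable {G : Type*} [Group G] {x y : G}

/-- The set `{x, x⁻¹}`: the choice of a sign at one letter of a braid word. -/
def signed (x : G) : Set G := {x, x⁻¹}

theorem inv_signed (x : G) : (signed x)⁻¹ = signed x := by
  simp [signed, Set.pair_comm]

theorem commute_signed (h : Commute x y) : Commute (signed x) (signed y) := by
  simp only [Commute, SemiconjBy, signed, Set.insert_eq, Set.union_mul, Set.mul_union,
    Set.singleton_mul_singleton, h.eq, h.inv_left.eq, h.inv_right.eq, h.inv_inv.eq,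
    Set.union_assoc, Set.union_left_comm]

theorem commute_singleton_signed (h : Commute x y) : Commute {x} (signed y) := by
  simp only [Commute, SemiconjBy, signed, Set.insert_eq, Set.mul_union, Set.union_mul,
    Set.singleton_mul_singleton, h.eq, h.inv_right.eq]

theorem inv_mul_inv_eq_self (h : x ^ 3 = 1) : x⁻¹ * x⁻¹ = x := by
  rw [← mul_inv_rev, inv_eq_iff_mul_eq_one, ← h, pow_three']

theorem mul_self_eq_inv (h : x ^ 3 = 1) : x * x = x⁻¹ :=
  eq_inv_of_mul_eq_one_left (by rw [← h, pow_three'])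

theorem signed_mul_signed_subset (h : x ^ 3 = 1) : signed x * signed x ⊆ 1 ∪ signed x := by
  rintro _ ⟨_, rfl | rfl, _, rfl | rfl, rfl⟩ <;>
    simp [signed, mul_self_eq_inv h, inv_mul_inv_eq_self h]

theorem signed_subset_signed_mul_signed (h : x ^ 3 = 1) : signed x ⊆ signed x * signed x := by
  rintro _ (rfl | rfl)
  · exact ⟨_, Or.inr rfl, _, Or.inr rfl, inv_mul_inv_eq_self h⟩
  · exact ⟨_, Or.inl rfl, _, Or.inl rfl, mul_self_eq_inv h⟩

/-- The braid relation between two elements of a group. -/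
def BraidRel (x y : G) : Prop := x * y * x = y * x * y

/-- The square of the half twist `x * y * x`. If `x` and `y` satisfy the braid relation, this is
the full twist on three strands, which generates the center of the braid group. -/
def fullTwist (x y : G) : G := x * y * x * (x * y * x)

namespace BraidRel

theorem symm (h : BraidRel x y) : BraidRel y x := Eq.symm h

theorem inv (h : BraidRel x y) : BraidRel x⁻¹ y⁻¹ := by
  simpa only [BraidRel, mul_inv_rev, mul_assoc] using congrArg (·⁻¹) h

theorem conj_eq (h : BraidRel x y) : x * y * x⁻¹ = y⁻¹ * x * y := by
  rw [mul_inv_eq_iff_eq_mul, mul_assoc, mul_assoc, eq_inv_mul_iff_mul_eq, ← mul_assoc, ← mul_assoc,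
    h]

theorem inv_conj_eq (h : BraidRel x y) : x⁻¹ * y⁻¹ * x = y * x⁻¹ * y⁻¹ := by
  simpa only [inv_inv] using h.inv.conj_eq

theorem fullTwist_comm (h : BraidRel x y) : fullTwist y x = fullTwist x y := by
  rw [fullTwist, fullTwist, h]

theorem semiconjBy_halfTwist (h : BraidRel x y) : SemiconjBy (x * y * x) x y :=
  calc x * y * x * x = y * x * y * x := by rw [h]
    _ = y * (x * y * x) := by simp only [mul_assoc]

theorem commute_fullTwist_left (h : BraidRel x y) : Commute (fullTwist x y) x :=
  SemiconjBy.mul_left (h.symm ▸ h.symm.semiconjBy_halfTwist) h.semiconjBy_halfTwist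

theorem commute_fullTwist_right (h : BraidRel x y) : Commute (fullTwist x y) y :=
  h.fullTwist_comm ▸ h.symm.commute_fullTwist_left

theorem alternating_eq (h : BraidRel x y) (hy : y ^ 3 = 1) :
    x * y⁻¹ * x = fullTwist x y * y := by
  have expand : fullTwist x y = y * (x * y⁻¹ * x) * y := by
    rw [fullTwist, h, ← mul_self_eq_inv hy]; simp only [mul_assoc]
  calc x * y⁻¹ * x = y⁻¹ * fullTwist x y * y⁻¹ := by rw [expand]; group
    _ = fullTwist x y * (y⁻¹ * y⁻¹) := by
      rw [← h.commute_fullTwist_right.inv_right.eq, mul_assoc]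
    _ = fullTwist x y * y := by rw [inv_mul_inv_eq_self hy]

theorem fullTwist_eq_left (h : BraidRel x y) (hy : y ^ 3 = 1) :
    fullTwist x y = x * y⁻¹ * x * y⁻¹ := by
  rw [h.alternating_eq hy, mul_inv_cancel_right]

theorem fullTwist_eq_right (h : BraidRel x y) (hx : x ^ 3 = 1) :
    fullTwist x y = y * x⁻¹ * y * x⁻¹ := by
  rw [← h.fullTwist_comm, h.symm.fullTwist_eq_left hx]

end BraidRel

/-- Two elements satisfying the defining relations of the quotient of the braid group on three
strands by the cubes of the standard generators. -/
structure CubicBraidPair (x y : G) : Prop where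
  braid : BraidRel x y
  cube_left : x ^ 3 = 1
  cube_right : y ^ 3 = 1

namespace CubicBraidPair

theorem symm (h : CubicBraidPair x y) : CubicBraidPair y x :=
  ⟨h.braid.symm, h.cube_right, h.cube_left⟩

theorem inv (h : CubicBraidPair x y) : CubicBraidPair x⁻¹ y⁻¹ :=
  ⟨h.braid.inv, by rw [inv_pow, h.cube_left, inv_one], by rw [inv_pow, h.cube_right, inv_one]⟩

theorem fullTwist_mul_self (h : CubicBraidPair x y) : fullTwist x y * fullTwist x y = 1 := by
  nth_rw 1 [h.braid.fullTwist_eq_left h.cube_right]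
  rw [h.braid.fullTwist_eq_right h.cube_left]
  group

theorem inv_fullTwist (h : CubicBraidPair x y) : (fullTwist x y)⁻¹ = fullTwist x y :=
  inv_eq_of_mul_eq_one_left h.fullTwist_mul_self

theorem fullTwist_inv_inv (h : CubicBraidPair x y) : fullTwist x⁻¹ y⁻¹ = fullTwist x y := by
  rw [← h.inv_fullTwist]
  simp only [fullTwist, mul_inv_rev, mul_assoc]

theorem inv_mul_mul_inv_eq (h : CubicBraidPair x y) : x⁻¹ * y * x⁻¹ = fullTwist x y * y⁻¹ := by
  simpa only [inv_inv, h.fullTwist_inv_inv] using h.inv.braid.alternating_eq h.inv.cube_right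

/-- Among the sign choices, `x * y⁻¹ * x` and `x⁻¹ * y * x⁻¹` are the two to which no braid relation
applies. -/
theorem signed_mul_signed_mul_signed_subset (h : CubicBraidPair x y) :
    signed x * signed y * signed x ⊆
      signed y * signed x * signed y ∪ {fullTwist x y} * signed y := by
  have flip {p q r : G} (hp : p ∈ signed y) (hq : q ∈ signed x) (hr : r ∈ signed y) :
      p * q * r ∈ signed y * signed x * signed y ∪ {fullTwist x y} * signed y :=
    Or.inl (Set.mul_mem_mul (Set.mul_mem_mul hp hq) hr)
  rintro _ ⟨_, ⟨_, rfl | rfl, _, rfl | rfl, rfl⟩, _, rfl | rfl, rfl⟩ <;> beta_reduce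
  · exact h.braid ▸ flip (Or.inl rfl) (Or.inl rfl) (Or.inl rfl)
  · exact h.braid.conj_eq ▸ flip (Or.inr rfl) (Or.inl rfl) (Or.inl rfl)
  · exact Or.inr ⟨_, rfl, _, Or.inl rfl, (h.braid.alternating_eq h.cube_right).symm⟩
  · exact h.braid.symm.inv_conj_eq ▸ flip (Or.inr rfl) (Or.inr rfl) (Or.inl rfl)
  · exact h.braid.symm.conj_eq ▸ flip (Or.inl rfl) (Or.inl rfl) (Or.inr rfl)
  · exact Or.inr ⟨_, rfl, _, Or.inr rfl, h.inv_mul_mul_inv_eq.symm⟩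
  · exact h.braid.inv_conj_eq ▸ flip (Or.inl rfl) (Or.inr rfl) (Or.inr rfl)
  · exact h.inv.braid ▸ flip (Or.inr rfl) (Or.inr rfl) (Or.inr rfl)

theorem fullTwist_mul_signed_subset (h : CubicBraidPair x y) :
    {fullTwist x y} * signed y ⊆ signed x * signed y * signed x := by
  rintro _ ⟨_, rfl, _, rfl | rfl, rfl⟩ <;> beta_reduce
  · rw [← h.braid.alternating_eq h.cube_right]
    exact Set.mul_mem_mul (Set.mul_mem_mul (Or.inl rfl) (Or.inr rfl)) (Or.inl rfl)
  · rw [← h.inv_mul_mul_inv_eq]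
    exact Set.mul_mem_mul (Set.mul_mem_mul (Or.inr rfl) (Or.inl rfl)) (Or.inr rfl)

end CubicBraidPair

/-- Three elements satisfying the defining relations of the quotient of the braid group on four
strands by the cubes of the standard generators. -/
structure CubicBraidTriple (a b c : G) : Prop where
  left : CubicBraidPair a b
  right : CubicBraidPair b c
  comm : Commute a c

/-- The letters `a`, `b`, `c` and their inverses. Including `1` makes the `n`-th power of this set
the set of products of at most `n` letters. -/
def letters (a b c : G) : Set G := 1 ∪ (signed a ∪ signed b ∪ signed c)

variable {a b c : G}

theorem one_subset_letters : 1 ⊆ letters a b c := Set.subset_union_left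

theorem signed_left_subset_letters : signed a ⊆ letters a b c :=
  fun _ h => Or.inr (Or.inl (Or.inl h))

theorem signed_mid_subset_letters : signed b ⊆ letters a b c :=
  fun _ h => Or.inr (Or.inl (Or.inr h))

theorem signed_right_subset_letters : signed c ⊆ letters a b c := fun _ h => Or.inr (Or.inr h)

theorem inv_letters : (letters a b c)⁻¹ = letters a b c := by
  simp only [letters, Set.union_inv, inv_one, inv_signed]

namespace CubicBraidTriple

theorem fullTwist_mul_fullTwist_mul (h : CubicBraidTriple a b c) :
    fullTwist a b * fullTwist b c * a = c * (fullTwist a b * fullTwist b c) := by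
  have product : fullTwist a b * fullTwist b c = a * b⁻¹ * a * c⁻¹ * b * c⁻¹ := by
    rw [h.left.braid.fullTwist_eq_left h.left.cube_right,
      ← h.right.braid.fullTwist_comm, h.right.symm.braid.fullTwist_eq_right h.right.cube_right]
    group
  rw [product]
  calc a * b⁻¹ * a * c⁻¹ * b * c⁻¹ * a
      = a * b⁻¹ * a * c⁻¹ * b * (c⁻¹ * a) := by simp only [mul_assoc]
    _ = a * b⁻¹ * (a * c⁻¹) * b * a * c⁻¹ := by
      rw [← h.comm.inv_right.eq]; simp only [mul_assoc]
    _ = a * b⁻¹ * c⁻¹ * (a * b * a) * c⁻¹ := by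
      rw [h.comm.inv_right.eq]; simp only [mul_assoc]
    _ = a * (b⁻¹ * c⁻¹ * b) * a * b * c⁻¹ := by
      rw [h.left.braid]; simp only [mul_assoc]
    _ = (a * c) * b⁻¹ * (c⁻¹ * a) * b * c⁻¹ := by
      rw [h.right.braid.inv_conj_eq]; simp only [mul_assoc]
    _ = c * (a * b⁻¹ * a * c⁻¹ * b * c⁻¹) := by
      rw [h.comm.eq, ← h.comm.inv_right.eq]; simp only [mul_assoc]

theorem conj_fullTwist (h : CubicBraidTriple a b c) :
    fullTwist b c * a * fullTwist b c = fullTwist a b * c * fullTwist a b :=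
  calc fullTwist b c * a * fullTwist b c
      = (fullTwist a b * fullTwist a b) * fullTwist b c * a * fullTwist b c := by
        rw [h.left.fullTwist_mul_self, one_mul]
    _ = fullTwist a b * (fullTwist a b * fullTwist b c * a) * fullTwist b c := by
        simp only [mul_assoc]
    _ = fullTwist a b * c * fullTwist a b * (fullTwist b c * fullTwist b c) := by
        rw [h.fullTwist_mul_fullTwist_mul]; simp only [mul_assoc]
    _ = fullTwist a b * c * fullTwist a b := by rw [h.right.fullTwist_mul_self, mul_one]

theorem conj_fullTwist_signed (h : CubicBraidTriple a b c) :
    {fullTwist b c} * signed a * {fullTwist b c} =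
      ({fullTwist a b} * signed c * {fullTwist a b} : Set G) := by
  have conj_inv : fullTwist b c * a⁻¹ * fullTwist b c = fullTwist a b * c⁻¹ * fullTwist a b := by
    simpa only [mul_inv_rev, h.left.inv_fullTwist, h.right.inv_fullTwist, mul_assoc]
      using congrArg (·⁻¹) h.conj_fullTwist
  simp only [signed, Set.insert_eq, Set.mul_union, Set.union_mul, Set.singleton_mul_singleton,
    h.conj_fullTwist, conj_inv]

variable (h : CubicBraidTriple a b c)
include h

theorem signed_right_mul_self_subset : signed c * signed c ⊆ letters a b c :=
  (signed_mul_signed_subset h.right.cube_right).trans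
    (Set.union_subset one_subset_letters signed_right_subset_letters)

theorem mul_mul_mul_fullTwist_subset :
    signed a * signed b * signed a * {fullTwist b c} ⊆ letters a b c ^ 6 := by
  have hA : signed a ⊆ letters a b c := signed_left_subset_letters
  have hB : signed b ⊆ letters a b c := signed_mid_subset_letters
  have hC : signed c ⊆ letters a b c := signed_right_subset_letters
  have comm := (commute_singleton_signed h.right.braid.commute_fullTwist_left).eq
  have twist : {fullTwist b c} * signed b ⊆ signed c * signed b * signed c := by
    simpa only [h.right.braid.fullTwist_comm] using h.right.symm.fullTwist_mul_signed_subset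
  have flipped : signed b * signed a * signed b * {fullTwist b c} ⊆ letters a b c ^ 6 :=
    calc _ = signed b * signed a * ({fullTwist b c} * signed b) := by rw [comm, mul_assoc]
      _ ⊆ letters a b c * letters a b c * (letters a b c * letters a b c * letters a b c) := by
        grw [twist]; gcongr
      _ = letters a b c ^ 5 := by simp only [pow_succ, pow_zero, one_mul, mul_assoc]
      _ ⊆ letters a b c ^ 6 := Set.pow_subset_pow_right (one_subset_letters rfl) (by norm_num)
  have twisted : {fullTwist a b} * signed b * {fullTwist b c} ⊆ letters a b c ^ 6 :=
    calc _ ⊆ {fullTwist a b} * (signed b * signed b) * {fullTwist b c} := by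
          grw [← signed_subset_signed_mul_signed h.left.cube_right]
      _ = {fullTwist a b} * signed b * ({fullTwist b c} * signed b) := by
          rw [comm]; simp only [mul_assoc]
      _ ⊆ signed a * signed b * signed a * (signed c * signed b * signed c) := by
          grw [twist, h.left.fullTwist_mul_signed_subset]
      _ ⊆ letters a b c * letters a b c * letters a b c *
            (letters a b c * letters a b c * letters a b c) := by gcongr
      _ = letters a b c ^ 6 := by simp only [pow_succ, pow_zero, one_mul, mul_assoc]
  grw [h.left.signed_mul_signed_mul_signed_subset, Set.union_mul]
  exact Set.union_subset flipped twisted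

theorem flip_flip_subset :
    signed a * (signed c * signed b * signed c) * signed a * (signed c * signed b * signed c) *
      signed a ⊆ letters a b c ^ 8 := by
  have hA : signed a ⊆ letters a b c := signed_left_subset_letters
  have hB : signed b ⊆ letters a b c := signed_mid_subset_letters
  have hC : signed c ⊆ letters a b c := signed_right_subset_letters
  have comm := (commute_signed h.comm).eq
  calc _ = signed a * signed c * signed b * (signed c * signed a * signed c) * signed b *
          (signed c * signed a) := by simp only [mul_assoc]
    _ = signed c * signed a * signed b * (signed a * (signed c * signed c)) * signed b *
          (signed a * signed c) := by rw [← comm]; simp only [mul_assoc]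
    _ ⊆ letters a b c * letters a b c * letters a b c * (letters a b c * letters a b c) *
          letters a b c * (letters a b c * letters a b c) := by
        grw [h.signed_right_mul_self_subset]; gcongr
    _ = letters a b c ^ 8 := by simp only [pow_succ, pow_zero, one_mul, mul_assoc]

theorem flip_twist_subset :
    signed a * (signed c * signed b * signed c) * signed a * ({fullTwist b c} * signed c) *
      signed a ⊆ letters a b c ^ 8 := by
  have hA : signed a ⊆ letters a b c := signed_left_subset_letters
  have hB : signed b ⊆ letters a b c := signed_mid_subset_letters
  have hC : signed c ⊆ letters a b c := signed_right_subset_letters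
  have comm := (commute_signed h.comm).eq
  have comm' := (commute_singleton_signed h.right.braid.commute_fullTwist_right).eq
  have cancelled : signed c * (signed a * signed b * signed a * {fullTwist b c}) * signed a ⊆
      letters a b c ^ 8 :=
    calc _ ⊆ letters a b c * letters a b c ^ 6 * letters a b c := by
          grw [h.mul_mul_mul_fullTwist_subset]; gcongr
      _ = letters a b c ^ 8 := by simp only [pow_succ, pow_zero, one_mul, mul_assoc]
  have remaining : signed c * signed a * signed b * signed a *
      ({fullTwist b c} * signed c) * signed a ⊆ letters a b c ^ 8 :=
    calc _ ⊆ letters a b c * letters a b c * letters a b c * letters a b c *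
            (letters a b c * letters a b c * letters a b c) * letters a b c := by
          grw [h.right.fullTwist_mul_signed_subset]; gcongr
      _ = letters a b c ^ 8 := by simp only [pow_succ, pow_zero, one_mul, mul_assoc]
  calc _ = signed a * signed c * signed b * (signed c * signed a) * {fullTwist b c} * signed c *
          signed a := by simp only [mul_assoc]
    _ = signed c * signed a * signed b * signed a * (signed c * {fullTwist b c}) * signed c *
          signed a := by rw [← comm]; simp only [mul_assoc]
    _ = signed c * signed a * signed b * signed a * {fullTwist b c} * (signed c * signed c) *
          signed a := by rw [← comm']; simp only [mul_assoc]
    _ ⊆ signed c * signed a * signed b * signed a * {fullTwist b c} * (1 ∪ signed c) *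
          signed a := by grw [signed_mul_signed_subset h.right.cube_right]
    _ ⊆ letters a b c ^ 8 := by
        simp only [Set.mul_union, Set.union_mul, mul_one, mul_assoc] at cancelled remaining ⊢
        exact Set.union_subset cancelled remaining

theorem twist_flip_subset :
    signed a * ({fullTwist b c} * signed c) * signed a * (signed c * signed b * signed c) *
      signed a ⊆ letters a b c ^ 8 := by
  rw [(commute_singleton_signed h.right.braid.commute_fullTwist_right).eq, ← Set.inv_subset_inv]
  simpa only [mul_inv_rev, ← inv_pow, inv_signed, inv_letters, Set.inv_singleton,
    h.right.inv_fullTwist, mul_assoc] using h.flip_twist_subset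

theorem twist_twist_subset :
    signed a * ({fullTwist b c} * signed c) * signed a * ({fullTwist b c} * signed c) *
      signed a ⊆ letters a b c ^ 8 := by
  have hA : signed a ⊆ letters a b c := signed_left_subset_letters
  have hB : signed b ⊆ letters a b c := signed_mid_subset_letters
  have hC : signed c ⊆ letters a b c := signed_right_subset_letters
  have comm := (commute_singleton_signed h.left.braid.commute_fullTwist_left).eq
  have comm' : signed a * {fullTwist b c} * signed c = signed c * (signed a * {fullTwist b c}) :=
    (commute_signed h.comm).mul_left
      (commute_singleton_signed h.right.braid.commute_fullTwist_right)
  have twist : {fullTwist a b} * signed a ⊆ signed b * signed a * signed b := by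
    simpa only [h.left.braid.fullTwist_comm] using h.left.symm.fullTwist_mul_signed_subset
  calc _ = signed a * {fullTwist b c} * signed c * (signed a * {fullTwist b c} * signed c) *
          signed a := by simp only [mul_assoc]
    _ = signed c * (signed a * {fullTwist b c} * signed c) * (signed a * {fullTwist b c}) *
          signed a := by rw [comm', ← mul_assoc, mul_assoc (signed c), ← comm']
    _ = signed c * signed c * signed a * ({fullTwist b c} * signed a * {fullTwist b c}) *
          signed a := by rw [comm']; simp only [mul_assoc]
    _ = signed c * signed c * (signed a * {fullTwist a b}) * signed c *
          ({fullTwist a b} * signed a) := by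
        rw [h.conj_fullTwist_signed]; simp only [mul_assoc]
    _ = signed c * signed c * ({fullTwist a b} * signed a) * signed c *
          ({fullTwist a b} * signed a) := by rw [comm]
    _ ⊆ letters a b c * (letters a b c * letters a b c * letters a b c) * letters a b c *
          (letters a b c * letters a b c * letters a b c) := by
        grw [h.signed_right_mul_self_subset, twist]; gcongr
    _ = letters a b c ^ 8 := by simp only [pow_succ, pow_zero, one_mul, mul_assoc]

theorem signed_nine_letter_word_subset :
    signed a * (signed b * signed c * signed b) * signed a * (signed b * signed c * signed b) *
      signed a ⊆ letters a b c ^ 8 := by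
  have flip_or_twist := h.right.signed_mul_signed_mul_signed_subset
  grw [flip_or_twist]
  simp only [Set.union_mul, Set.mul_union]
  exact Set.union_subset (Set.union_subset h.flip_flip_subset h.twist_flip_subset)
    (Set.union_subset h.flip_twist_subset h.twist_twist_subset)

end CubicBraidTriple

end CubicBraid

theorem isTangleWord_append {u v : List Piece} {m n : ℕ} :
    IsTangleWord m (u ++ v) n ↔ ∃ k, IsTangleWord m u k ∧ IsTangleWord k v n := by
  induction u generalizing m with
  | nil => simp [IsTangleWord]
  | cons x u ih => simp [IsTangleWord, ih, and_assoc]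

namespace TangleDiagram

variable {k m n : ℕ}

/-- The diagram `D` stacked on top of the diagram `E`. -/
def comp (D : TangleDiagram k m) (E : TangleDiagram m n) : TangleDiagram k n where
  pieces := D.pieces ++ E.pieces
  isTangleWord := isTangleWord_append.2 ⟨m, D.isTangleWord, E.isTangleWord⟩

theorem numCrossings_comp (D : TangleDiagram k m) (E : TangleDiagram m n) :
    (D.comp E).numCrossings = D.numCrossings + E.numCrossings :=
  List.countP_append

theorem eqvGen_comp {R : List Piece → List Piece → Prop} {D D' : TangleDiagram k m}
    {E E' : TangleDiagram m n} (hD : Relation.EqvGen (StepBy R) D D')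
    (hE : Relation.EqvGen (StepBy R) E E') :
    Relation.EqvGen (StepBy R) (D.comp E) (D'.comp E') := by
  have above : Relation.EqvGen (StepBy R) (D.comp E) (D'.comp E) := by
    refine ((Relation.EqvGen.is_equivalence _).comap (comp · E)).eqvGen_iff.1 (hD.mono ?_)
    rintro D D' ⟨u, x, y, v, hR, hD, hD'⟩
    exact .rel _ _ ⟨u, x, y, v ++ E.pieces, hR, by simp [comp, hD], by simp [comp, hD']⟩
  have below : Relation.EqvGen (StepBy R) (D'.comp E) (D'.comp E') := by
    refine ((Relation.EqvGen.is_equivalence _).comap D'.comp).eqvGen_iff.1 (hE.mono ?_)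
    rintro E E' ⟨u, x, y, v, hR, hE, hE'⟩
    exact .rel _ _ ⟨D'.pieces ++ u, x, y, v, hR, by simp [comp, hE], by simp [comp, hE']⟩
  exact above.trans _ _ _ below

theorem PlanarIsotopic.threeMoveEquivalent {D D' : TangleDiagram m n} (h : D.PlanarIsotopic D') :
    D.ThreeMoveEquivalent D' :=
  h.mono fun _ _ ⟨u, x, y, v, hR, hD⟩ => ⟨u, x, y, v, Or.inl hR, hD⟩

theorem PlanarIsotopic.numCrossings_eq {D D' : TangleDiagram m n} (h : D.PlanarIsotopic D') :
    D.numCrossings = D'.numCrossings := by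
  refine (eq_equivalence.comap numCrossings).eqvGen_iff.1 (h.mono ?_)
  rintro D D' ⟨u, x, y, v, hR, hD, hD'⟩
  have move : x.countP Piece.isCrossing = y.countP Piece.isCrossing := by
    cases hR with
    | exchange a b i k => cases a <;> cases b <;> rfl
    | zigzag_right i => rfl
    | zigzag_left i => rfl
    | slide_min i s => rfl
    | slide_max i s => rfl
  simp only [Function.onFun, numCrossings, hD, hD', List.countP_append, move]

/-- Stacking is associative on the nose, because diagrams are words of events. -/
instance : Monoid (TangleDiagram n n) where
  mul := comp
  one := ⟨[], rfl⟩
  mul_assoc _ _ _ := TangleDiagram.ext (List.append_assoc _ _ _)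
  one_mul _ := TangleDiagram.ext (List.nil_append _)
  mul_one _ := TangleDiagram.ext (List.append_nil _)

/-- 3-move equivalence as a congruence on the monoid of tangle diagrams with `n` endpoints on
either side. -/
def threeMoveCon (n : ℕ) : Con (TangleDiagram n n) where
  r := ThreeMoveEquivalent
  iseqv := Relation.EqvGen.is_equivalence _
  mul' := eqvGen_comp

theorem mk_eq_mk_of_move {D D' : TangleDiagram n n}
    (h : PlanarMove D.pieces D'.pieces ∨ ReidemeisterMove D.pieces D'.pieces ∨
      ThreeMove D.pieces D'.pieces) : (D : (threeMoveCon n).Quotient) = D' :=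
  (Con.eq _).2 (.rel _ _ ⟨[], _, _, [], h, by simp, by simp⟩)

/-- The standard generator of the braid group on `k + 1` strands that crosses the strands `i` and
`i + 1`, or its inverse, depending on `s`. -/
def crossing (i : Fin k) (s : Bool) : TangleDiagram (k + 1) (k + 1) where
  pieces := [crossAt i s]
  isTangleWord := by
    have := i.isLt
    exact ⟨show (i : ℕ) + 2 ≤ k + 1 by omega, show k + 1 - 2 + 2 = k + 1 by omega⟩

theorem mk_crossing_mul_mk_crossing_not (i : Fin k) (s : Bool) :
    (crossing i s * crossing i (!s) : (threeMoveCon (k + 1)).Quotient) = 1 :=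
  mk_eq_mk_of_move (D := crossing i s * crossing i (!s)) (D' := 1) (.inr (.inl (.r2 i s)))

/-- A crossing as an element of the group of invertible tangles modulo 3-moves. -/
def crossingUnit (i : Fin k) (s : Bool) : (threeMoveCon (k + 1)).Quotientˣ where
  val := crossing i s
  inv := crossing i (!s)
  val_inv := mk_crossing_mul_mk_crossing_not i s
  inv_val := by simpa only [Bool.not_not] using mk_crossing_mul_mk_crossing_not i (!s)

theorem crossingUnit_mem_signed (i : Fin k) (s : Bool) :
    crossingUnit i s ∈ signed (crossingUnit i true) := by
  cases s
  exacts [Or.inr (Units.ext rfl), Or.inl rfl]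

theorem crossingUnit_cube (i : Fin k) (s : Bool) : crossingUnit i s ^ 3 = 1 := by
  refine Units.ext (Eq.symm ?_)
  rw [pow_three']
  exact mk_eq_mk_of_move (D := 1) (D' := crossing i s * crossing i s * crossing i s)
    (.inr (.inr (.twist i s)))

theorem braidRel_crossingUnit {i j : Fin k} (h : (j : ℕ) = i + 1) (s : Bool) :
    BraidRel (crossingUnit i s) (crossingUnit j s) := by
  refine Units.ext (mk_eq_mk_of_move (D := crossing i s * crossing j s * crossing i s)
    (D' := crossing j s * crossing i s * crossing j s) (.inr (.inl ?_)))
  have r3 := ReidemeisterMove.r3 i s s s (Or.inl rfl)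
  rwa [← h] at r3

theorem commute_crossingUnit {i j : Fin k} (h : (i : ℕ) + 2 ≤ j) (s t : Bool) :
    Commute (crossingUnit i s) (crossingUnit j t) := by
  refine Units.ext (mk_eq_mk_of_move (D := crossing i s * crossing j t)
    (D' := crossing j t * crossing i s) (.inl ?_))
  obtain ⟨d, hd⟩ := Nat.exists_eq_add_of_le h
  have exchange := PlanarMove.exchange (.crossing s) (.crossing t) i d
  rwa [PieceKind.ins, PieceKind.outs, ← hd] at exchange

theorem cubicBraidPair_crossingUnit {i j : Fin k} (h : (j : ℕ) = i + 1) (s : Bool) :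
    CubicBraidPair (crossingUnit i s) (crossingUnit j s) :=
  ⟨braidRel_crossingUnit h s, crossingUnit_cube i s, crossingUnit_cube j s⟩

theorem cubicBraidTriple_crossingUnit {i j l : Fin k} (hij : (j : ℕ) = i + 1)
    (hjl : (l : ℕ) = j + 1) (s : Bool) :
    CubicBraidTriple (crossingUnit i s) (crossingUnit j s) (crossingUnit l s) :=
  ⟨cubicBraidPair_crossingUnit hij s, cubicBraidPair_crossingUnit hjl s,
    commute_crossingUnit (by omega) s s⟩

/-- The invertible tangles modulo 3-moves that have a diagram with at most `k` crossings. -/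
def unitsOfCrossingsLE (n k : ℕ) : Set (threeMoveCon n).Quotientˣ :=
  {g | ∃ D : TangleDiagram n n, D.numCrossings ≤ k ∧ (D : (threeMoveCon n).Quotient) = g}

theorem signed_crossingUnit_subset (i : Fin k) :
    signed (crossingUnit i true) ⊆ unitsOfCrossingsLE (k + 1) 1 := by
  rintro _ (rfl | rfl)
  exacts [⟨crossing i true, le_rfl, rfl⟩, ⟨crossing i false, le_rfl, rfl⟩]

open scoped Pointwise in
theorem pow_unitsOfCrossingsLE_subset (n k : ℕ) :
    unitsOfCrossingsLE n 1 ^ k ⊆ unitsOfCrossingsLE n k := by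
  induction k with
  | zero => rintro _ rfl; exact ⟨1, le_rfl, rfl⟩
  | succ k ih =>
    rw [pow_succ]
    rintro _ ⟨g, hg, g', ⟨D', hD', h'⟩, rfl⟩
    obtain ⟨D, hD, h⟩ := ih hg
    refine ⟨D * D', ?_, by rw [Con.coe_mul, h, h', Units.val_mul]⟩
    exact (numCrossings_comp D D').trans_le (Nat.add_le_add hD hD')

theorem letters_crossingUnit_subset (i j l : Fin k) :
    letters (crossingUnit i true) (crossingUnit j true) (crossingUnit l true) ⊆
      unitsOfCrossingsLE (k + 1) 1 := by
  have one_mem : 1 ∈ unitsOfCrossingsLE (k + 1) 1 := ⟨1, Nat.zero_le _, rfl⟩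
  exact Set.union_subset (Set.singleton_subset_iff.2 one_mem) (Set.union_subset
    (Set.union_subset (signed_crossingUnit_subset i) (signed_crossingUnit_subset j))
    (signed_crossingUnit_subset l))

/-- The braid with signed word `a b c b a b c b a`, where `a`, `b`, `c` are the crossings at `i`,
`j`, `l`. It is a braid on four strands if `j = i + 1` and `l = i + 2`. -/
def nineLetterBraid (i j l : Fin k) (s₁ s₂ s₃ s₄ s₅ s₆ s₇ s₈ s₉ : Bool) :
    TangleDiagram (k + 1) (k + 1) :=
  crossing i s₁ * (crossing j s₂ * crossing l s₃ * crossing j s₄) * crossing i s₅ *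
    (crossing j s₆ * crossing l s₇ * crossing j s₈) * crossing i s₉

theorem exists_threeMoveEquivalent_nineLetterBraid {i j l : Fin k} (hij : (j : ℕ) = i + 1)
    (hjl : (l : ℕ) = j + 1) (s₁ s₂ s₃ s₄ s₅ s₆ s₇ s₈ s₉ : Bool) :
    ∃ D, (nineLetterBraid i j l s₁ s₂ s₃ s₄ s₅ s₆ s₇ s₈ s₉).ThreeMoveEquivalent D ∧
      D.numCrossings ≤ 8 := by
  let word := crossingUnit i s₁ * (crossingUnit j s₂ * crossingUnit l s₃ * crossingUnit j s₄) *
    crossingUnit i s₅ * (crossingUnit j s₆ * crossingUnit l s₇ * crossingUnit j s₈) *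
    crossingUnit i s₉
  have mem := crossingUnit_mem_signed (k := k)
  have mem_block (s t u) : crossingUnit j s * crossingUnit l t * crossingUnit j u ∈ _ :=
    Set.mul_mem_mul (Set.mul_mem_mul (mem j s) (mem l t)) (mem j u)
  have word_mem : word ∈ _ := Set.mul_mem_mul (Set.mul_mem_mul (Set.mul_mem_mul (Set.mul_mem_mul
    (mem i s₁) (mem_block s₂ s₃ s₄)) (mem i s₅)) (mem_block s₆ s₇ s₈)) (mem i s₉)
  have short := (cubicBraidTriple_crossingUnit hij hjl true).signed_nine_letter_word_subset
    word_mem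
  obtain ⟨D, hD, h⟩ := pow_unitsOfCrossingsLE_subset (k + 1) 8
    (Set.pow_subset_pow_left (letters_crossingUnit_subset i j l) short)
  exact ⟨D, (Con.eq _).1 h.symm, hD⟩

/-- The diagram obtained by joining the upper ends `0`, `1`, `2`, `3` by two nested arcs, and
likewise the lower ends `4`, `5`, `6`, `7`. For a braid on the strands `2`, `3`, `4`, `5` this bends
its two left upper ends down and its two right lower ends up. -/
def bend (D : TangleDiagram 8 8) : TangleDiagram 4 4 :=
  (comp ⟨[maxAt 0, maxAt 1], by simp [IsTangleWord, maxAt, PieceKind.ins, PieceKind.outs]⟩ D).comp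
    ⟨[minAt 5, minAt 4], by simp [IsTangleWord, minAt, PieceKind.ins, PieceKind.outs]⟩

theorem numCrossings_bend (D : TangleDiagram 8 8) : D.bend.numCrossings = D.numCrossings := by
  simp only [bend, numCrossings_comp]
  simp [numCrossings, Piece.isCrossing, maxAt, minAt]

theorem ThreeMoveEquivalent.bend {D D' : TangleDiagram 8 8} (h : D.ThreeMoveEquivalent D') :
    D.bend.ThreeMoveEquivalent D'.bend :=
  eqvGen_comp (eqvGen_comp (.refl _) h) (.refl _)

end TangleDiagram

/-- The word of a diagram that arises from `nineVertexConfiguration` by choosing crossings, the sign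
at each vertex being named after it. -/
def nineVertexWord (a b c d e f l m r : Bool) : List Piece :=
  [maxAt 2, crossAt 1 a, crossAt 3 d, crossAt 0 e, crossAt 4 f, crossAt 1 b, crossAt 3 c, minAt 2,
    crossAt 1 m, crossAt 0 l, crossAt 2 r]

/-- Every tangle diagram with events `x` is planar isotopic to one with events `y`. -/
def IsotopesTo (x y : List Piece) : Prop :=
  ∀ ⦃m n : ℕ⦄ (hx : IsTangleWord m x n),
    ∃ hy : IsTangleWord m y n, (⟨x, hx⟩ : TangleDiagram m n).PlanarIsotopic ⟨y, hy⟩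

namespace IsotopesTo

variable {x y z : List Piece}

theorem refl (x : List Piece) : IsotopesTo x x := fun _ _ hx => ⟨hx, .refl _⟩

theorem trans (h : IsotopesTo x y) (h' : IsotopesTo y z) : IsotopesTo x z := fun _ _ hx =>
  have ⟨hy, hxy⟩ := h hx
  have ⟨hz, hyz⟩ := h' hy
  ⟨hz, hxy.trans _ _ _ hyz⟩

instance : Trans IsotopesTo IsotopesTo IsotopesTo := ⟨trans⟩

theorem context (u v : List Piece) (h : IsotopesTo x y) :
    IsotopesTo (u ++ x ++ v) (u ++ y ++ v) := by
  intro m n huxv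
  obtain ⟨l, hux, hv⟩ := isTangleWord_append.1 huxv
  obtain ⟨k, hu, hx⟩ := isTangleWord_append.1 hux
  obtain ⟨hy, hxy⟩ := h hx
  let D : TangleDiagram m k := ⟨u, hu⟩
  let E : TangleDiagram l n := ⟨v, hv⟩
  exact ⟨_, TangleDiagram.eqvGen_comp (TangleDiagram.eqvGen_comp (.refl D) hxy) (.refl E)⟩

theorem of_move (h : PlanarMove x y)
    (valid : ∀ {m n}, IsTangleWord m x n → IsTangleWord m y n) : IsotopesTo x y := fun _ _ hx =>
  ⟨valid hx, .rel _ _ ⟨[], x, y, [], h, by simp, by simp⟩⟩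

theorem of_move_symm (h : PlanarMove y x)
    (valid : ∀ {m n}, IsTangleWord m x n → IsTangleWord m y n) : IsotopesTo x y := fun _ _ hx =>
  ⟨valid hx, .symm _ _ (.rel _ _ ⟨[], y, x, [], h, by simp, by simp⟩)⟩

theorem exchange (a b : PieceKind) (i k : ℕ) :
    IsotopesTo [⟨a, i⟩, ⟨b, i + a.outs + k⟩] [⟨b, i + a.ins + k⟩, ⟨a, i⟩] :=
  of_move (.exchange a b i k) fun h => by
    simp only [IsTangleWord] at h ⊢
    omega

theorem slide_min_symm (i : ℕ) (s : Bool) :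
    IsotopesTo [crossAt i s, minAt (i + 1)] [crossAt (i + 1) (!s), minAt i] :=
  of_move_symm (by simpa using PlanarMove.slide_min i (!s)) fun h => by
    simp only [IsTangleWord, crossAt, minAt, PieceKind.ins, PieceKind.outs] at h ⊢
    omega

theorem slide_max (i : ℕ) (s : Bool) :
    IsotopesTo [maxAt i, crossAt (i + 1) s] [maxAt (i + 1), crossAt i (!s)] :=
  of_move (.slide_max i s) fun h => by
    simp only [IsTangleWord, crossAt, maxAt, PieceKind.ins, PieceKind.outs] at h ⊢
    omega

theorem zigzag_right (i : ℕ) : IsotopesTo [maxAt i, minAt (i + 1)] [] :=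
  of_move (.zigzag_right i) fun h => by
    simp only [IsTangleWord, minAt, maxAt, PieceKind.ins, PieceKind.outs] at h ⊢
    omega

theorem exchange_word (a : PieceKind) (i : ℕ) (v : List Piece) :
    IsotopesTo (⟨a, i⟩ :: v.map fun p => ⟨p.kind, i + a.outs + p.pos⟩)
      ((v.map fun p => ⟨p.kind, i + a.ins + p.pos⟩) ++ [⟨a, i⟩]) := by
  induction v with
  | nil => exact refl _
  | cons p v ih =>
    have first := (exchange a p.kind i p.pos).context []
      (v.map fun p => ⟨p.kind, i + a.outs + p.pos⟩)
    have rest := ih.context [⟨p.kind, i + a.ins + p.pos⟩] []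
    rw [List.append_nil, List.append_nil] at rest
    exact first.trans rest

theorem nested_max_crossing (i : ℕ) (s : Bool) :
    IsotopesTo [maxAt i, maxAt (i + 1), crossAt (i + 2) s]
      [maxAt i, maxAt (i + 1), crossAt i s] :=
  calc
    IsotopesTo _ [maxAt i, maxAt (i + 2), crossAt (i + 1) !s] :=
      (slide_max (i + 1) s).context [maxAt i] []
    IsotopesTo _ [maxAt i, maxAt i, crossAt (i + 1) !s] :=
      (exchange .maximum .maximum i 0).context [] [crossAt (i + 1) !s]
    IsotopesTo _ [maxAt i, maxAt (i + 1), crossAt i s] := by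
      have slide := slide_max i !s
      rw [Bool.not_not] at slide
      exact slide.context [maxAt i] []

/-- Rotating a crossing by a quarter turn reverses its sign. -/
theorem quarter_turn (i : ℕ) (s : Bool) :
    IsotopesTo [maxAt i, crossAt (i + 1) s, minAt (i + 2)] [crossAt i !s] :=
  calc
    IsotopesTo _ [maxAt i, crossAt (i + 2) !s, minAt (i + 1)] :=
      (slide_min_symm (i + 1) s).context [maxAt i] []
    IsotopesTo _ [crossAt i !s, maxAt i, minAt (i + 1)] :=
      (exchange .maximum (.crossing !s) i 0).context [] [minAt (i + 1)]
    IsotopesTo _ [crossAt i !s] := (zigzag_right i).context [crossAt i !s] []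

theorem max_crossing_crossing (i : ℕ) (s t : Bool) :
    IsotopesTo [maxAt i, crossAt (i + 1) s, crossAt (i + 2) t]
      [maxAt (i + 2), crossAt (i + 1) !t, crossAt i !s] :=
  calc
    IsotopesTo _ [maxAt (i + 1), crossAt i !s, crossAt (i + 2) t] :=
      (slide_max i s).context [] [crossAt (i + 2) t]
    IsotopesTo _ [maxAt (i + 1), crossAt (i + 2) t, crossAt i !s] :=
      (exchange (.crossing !s) (.crossing t) i 0).context [maxAt (i + 1)] []
    IsotopesTo _ [maxAt (i + 2), crossAt (i + 1) !t, crossAt i !s] :=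
      (slide_max (i + 1) t).context [] [crossAt i !s]

theorem crossing_crossing_min_min (i : ℕ) (s t : Bool) :
    IsotopesTo [crossAt (i + 1) s, crossAt i t, minAt (i + 2), minAt (i + 1)]
      [crossAt (i + 2) !s, crossAt (i + 3) !t, minAt (i + 1), minAt i] :=
  calc
    IsotopesTo _ [crossAt (i + 1) s, minAt (i + 2), crossAt i t, minAt (i + 1)] :=
      (exchange (.crossing t) .minimum i 0).context [crossAt (i + 1) s] [minAt (i + 1)]
    IsotopesTo _ [crossAt (i + 2) !s, minAt (i + 1), crossAt (i + 1) !t, minAt i] :=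
      ((slide_min_symm (i + 1) s).context [] [crossAt i t, minAt (i + 1)]).trans
        ((slide_min_symm i t).context [crossAt (i + 2) !s, minAt (i + 1)] [])
    IsotopesTo _ [crossAt (i + 2) !s, crossAt (i + 3) !t, minAt (i + 1), minAt i] :=
      (exchange .minimum (.crossing !t) (i + 1) 0).context [crossAt (i + 2) !s] [minAt i]

theorem max_block_min_min (i : ℕ) (s t u : Bool) :
    IsotopesTo
      [maxAt i, crossAt (i + 1) s, crossAt (i + 2) t, crossAt (i + 1) u, minAt (i + 3),
        minAt (i + 2)]
      [crossAt (i + 1) !t, crossAt (i + 2) !u, crossAt (i + 1) s, minAt i] :=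
  calc
    IsotopesTo _ [maxAt i, crossAt (i + 1) s, crossAt (i + 3) !t, crossAt (i + 4) !u,
        minAt (i + 2), minAt (i + 1)] :=
      (crossing_crossing_min_min (i + 1) t u).context [maxAt i, crossAt (i + 1) s] []
    IsotopesTo _ [maxAt i, crossAt (i + 3) !t, crossAt (i + 4) !u, crossAt (i + 1) s,
        minAt (i + 2), minAt (i + 1)] :=
      (exchange_word (.crossing s) (i + 1) [crossAt 0 !t, crossAt 1 !u]).context [maxAt i]
        [minAt (i + 2), minAt (i + 1)]
    IsotopesTo _ [crossAt (i + 1) !t, crossAt (i + 2) !u, maxAt i, crossAt (i + 1) s,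
        minAt (i + 2), minAt (i + 1)] :=
      (exchange_word .maximum i [crossAt 1 !t, crossAt 2 !u]).context []
        [crossAt (i + 1) s, minAt (i + 2), minAt (i + 1)]
    IsotopesTo _ [crossAt (i + 1) !t, crossAt (i + 2) !u, crossAt i !s, minAt (i + 1)] :=
      (quarter_turn i s).context [crossAt (i + 1) !t, crossAt (i + 2) !u] [minAt (i + 1)]
    IsotopesTo _ [crossAt (i + 1) !t, crossAt (i + 2) !u, crossAt (i + 1) s, minAt i] := by
      have slide := slide_min_symm i !s
      rw [Bool.not_not] at slide
      exact slide.context [crossAt (i + 1) !t, crossAt (i + 2) !u] []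

theorem bent_outer_crossings (a b c d e f l m r : Bool) :
    IsotopesTo
      [maxAt 0, maxAt 1, crossAt 2 l, crossAt 3 e, crossAt 4 a, crossAt 3 b, crossAt 2 m,
        crossAt 3 c, crossAt 4 d, crossAt 3 f, crossAt 2 r, minAt 5, minAt 4]
      [maxAt 0, maxAt 1, crossAt 3 e, crossAt 4 a, crossAt 3 b, crossAt 2 m, crossAt 3 c,
        crossAt 4 d, crossAt 3 f, minAt 5, minAt 4, crossAt 0 l, crossAt 2 r] :=
  calc
    IsotopesTo _
        [maxAt 0, maxAt 1, crossAt 0 l, crossAt 3 e, crossAt 4 a, crossAt 3 b, crossAt 2 m,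
          crossAt 3 c, crossAt 4 d, crossAt 3 f, crossAt 2 r, minAt 5, minAt 4] :=
      (nested_max_crossing 0 l).context [] [_, _, _, _, _, _, _, _, _, _]
    IsotopesTo _
        [maxAt 0, maxAt 1, crossAt 0 l, crossAt 3 e, crossAt 4 a, crossAt 3 b, crossAt 2 m,
          crossAt 3 c, crossAt 4 d, crossAt 3 f, minAt 5, minAt 4, crossAt 2 r] :=
      (exchange_word (.crossing r) 2 [minAt 1, minAt 0]).context
        [_, _, _, _, _, _, _, _, _, _] []
    IsotopesTo _
        [maxAt 0, maxAt 1, crossAt 3 e, crossAt 4 a, crossAt 3 b, crossAt 2 m, crossAt 3 c,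
          crossAt 4 d, crossAt 3 f, minAt 5, minAt 4, crossAt 0 l, crossAt 2 r] :=
      (exchange_word (.crossing l) 0 [crossAt 1 e, crossAt 2 a, crossAt 1 b, crossAt 0 m,
        crossAt 1 c, crossAt 2 d, crossAt 1 f, minAt 3, minAt 2]).context [maxAt 0, maxAt 1]
        [crossAt 2 r]

theorem bent_middle_crossing (a b c d e f m : Bool) :
    IsotopesTo
      [maxAt 0, maxAt 1, crossAt 3 e, crossAt 4 a, crossAt 3 b, crossAt 2 m, crossAt 3 c,
        crossAt 4 d, crossAt 3 f, minAt 5, minAt 4]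
      [maxAt 0, crossAt 1 e, crossAt 2 a, crossAt 1 b, maxAt 2, crossAt 3 c, crossAt 4 d,
        crossAt 3 f, minAt 5, minAt 4, crossAt 1 !m] :=
  calc
    IsotopesTo _
        [maxAt 0, crossAt 1 e, crossAt 2 a, crossAt 1 b, maxAt 1, crossAt 2 m, crossAt 3 c,
          crossAt 4 d, crossAt 3 f, minAt 5, minAt 4] :=
      (exchange_word .maximum 1 [crossAt 0 e, crossAt 1 a, crossAt 0 b]).context [maxAt 0]
        [_, _, _, _, _, _]
    IsotopesTo _
        [maxAt 0, crossAt 1 e, crossAt 2 a, crossAt 1 b, maxAt 2, crossAt 1 !m, crossAt 3 c,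
          crossAt 4 d, crossAt 3 f, minAt 5, minAt 4] :=
      (slide_max 1 m).context [_, _, _, _] [_, _, _, _, _]
    IsotopesTo _
        [maxAt 0, crossAt 1 e, crossAt 2 a, crossAt 1 b, maxAt 2, crossAt 3 c, crossAt 4 d,
          crossAt 3 f, minAt 5, minAt 4, crossAt 1 !m] :=
      (exchange_word (.crossing !m) 1 [crossAt 0 c, crossAt 1 d, crossAt 0 f, minAt 2,
        minAt 1]).context [_, _, _, _, _] []

theorem bent_side_blocks (a b c d e f : Bool) :
    IsotopesTo
      [maxAt 0, crossAt 1 e, crossAt 2 a, crossAt 1 b, maxAt 2, crossAt 3 c, crossAt 4 d,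
        crossAt 3 f, minAt 5, minAt 4]
      [maxAt 2, crossAt 1 !a, crossAt 3 !d, crossAt 0 !e, crossAt 4 !f, crossAt 1 b, crossAt 3 c,
        minAt 2] :=
  calc
    IsotopesTo _
        [maxAt 2, crossAt 1 !a, crossAt 0 !e, crossAt 1 b, maxAt 2, crossAt 3 c, crossAt 4 d,
          crossAt 3 f, minAt 5, minAt 4] :=
      (max_crossing_crossing 0 e a).context [] [_, _, _, _, _, _, _]
    IsotopesTo _
        [maxAt 2, crossAt 1 !a, crossAt 0 !e, crossAt 1 b, crossAt 3 !d, crossAt 4 !f, crossAt 3 c,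
          minAt 2] :=
      (max_block_min_min 2 c d f).context [_, _, _, _] []
    IsotopesTo _
        [maxAt 2, crossAt 1 !a, crossAt 0 !e, crossAt 3 !d, crossAt 4 !f, crossAt 1 b, crossAt 3 c,
          minAt 2] :=
      (exchange_word (.crossing b) 1 [crossAt 0 !d, crossAt 1 !f]).context [_, _, _] [_, _]
    IsotopesTo _
        [maxAt 2, crossAt 1 !a, crossAt 3 !d, crossAt 0 !e, crossAt 4 !f, crossAt 1 b, crossAt 3 c,
          minAt 2] :=
      (exchange (.crossing !e) (.crossing !d) 0 1).context [_, _] [_, _, _, _]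

theorem bend_nineLetterBraid (a b c d e f l m r : Bool) :
    IsotopesTo (TangleDiagram.nineLetterBraid (k := 7) 2 3 4 l e a b m c d f r).bend.pieces
      (nineVertexWord (!a) b c (!d) (!e) (!f) l (!m) r) :=
  (bent_outer_crossings a b c d e f l m r).trans <|
    ((bent_middle_crossing a b c d e f m).context [] [crossAt 0 l, crossAt 2 r]).trans <|
      (bent_side_blocks a b c d e f).context [] [crossAt 1 !m, crossAt 0 l, crossAt 2 r]

end IsotopesTo

namespace Piece

theorem toGraphPiece_eq_maximum_iff {x : Piece} {i : ℕ} :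
    x.toGraphPiece = .maximum i ↔ x = maxAt i := by
  obtain ⟨_ | _ | s, j⟩ := x <;> simp [toGraphPiece, maxAt]

theorem toGraphPiece_eq_minimum_iff {x : Piece} {i : ℕ} :
    x.toGraphPiece = .minimum i ↔ x = minAt i := by
  obtain ⟨_ | _ | s, j⟩ := x <;> simp [toGraphPiece, minAt]

theorem toGraphPiece_eq_vertex_iff {x : Piece} {i : ℕ} :
    x.toGraphPiece = .vertex i ↔ ∃ s, x = crossAt i s := by
  obtain ⟨_ | _ | s, j⟩ := x <;> simp [toGraphPiece, crossAt]

end Piece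

theorem exists_eq_nineVertexWord {p : List Piece}
    (h : p.map Piece.toGraphPiece = nineVertexConfiguration) :
    ∃ a b c d e f l m r, p = nineVertexWord a b c d e f l m r := by
  simp only [nineVertexConfiguration, List.map_eq_cons_iff, List.map_eq_nil_iff,
    Piece.toGraphPiece_eq_maximum_iff, Piece.toGraphPiece_eq_minimum_iff,
    Piece.toGraphPiece_eq_vertex_iff] at h
  obtain ⟨_, _, rfl, rfl, _, _, rfl, ⟨a, rfl⟩, _, _, rfl, ⟨d, rfl⟩, _, _, rfl, ⟨e, rfl⟩, _, _, rfl,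
    ⟨f, rfl⟩, _, _, rfl, ⟨b, rfl⟩, _, _, rfl, ⟨c, rfl⟩, _, _, rfl, rfl, _, _, rfl, ⟨m, rfl⟩, _, _,
    rfl, ⟨l, rfl⟩, _, _, rfl, ⟨r, rfl⟩, rfl⟩ := h
  exact ⟨a, b, c, d, e, f, l, m, r, rfl⟩

theorem lemma2p5 (T : TangleDiagram 4 4) (hT : T.SupportedBy nineVertexConfiguration) :
    T.numCrossings = 9 ∧
      ∃ T' : TangleDiagram 4 4, T.ThreeMoveEquivalent T' ∧ T'.numCrossings < 9 := by
  obtain ⟨⟨p, hp⟩, hTD, hD⟩ := hT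
  obtain ⟨a, b, c, d, e, f, l, m, r, rfl⟩ := exists_eq_nineVertexWord hD
  refine ⟨hTD.numCrossings_eq, ?_⟩
  let B := TangleDiagram.nineLetterBraid (k := 7) 2 3 4 l (!e) (!a) b (!m) c (!d) (!f) r
  obtain ⟨B', hBB', hB'⟩ : ∃ B', B.ThreeMoveEquivalent B' ∧ B'.numCrossings ≤ 8 :=
    TangleDiagram.exists_threeMoveEquivalent_nineLetterBraid rfl rfl ..
  have isotopy : B.bend.PlanarIsotopic ⟨_, hp⟩ := by
    have ⟨_, h⟩ := IsotopesTo.bend_nineLetterBraid (!a) b c (!d) (!e) (!f) l (!m) r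
      B.bend.isTangleWord
    simpa only [Bool.not_not] using h
  refine ⟨B'.bend, ?_, by rw [TangleDiagram.numCrossings_bend]; omega⟩
  have hTB : T.PlanarIsotopic B.bend := hTD.trans _ _ _ (isotopy.symm _ _)
  exact hTB.threeMoveEquivalent.trans _ _ _ hBB'.bend
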